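/- Let $\tilde G$ be a finite extensive-form pseudogame with finite set of players $\mathcal P$, $N$ nodes (inner nodes and leaves), nature strategy $\sigma_0$, and, at each leaf $z$ and for each player $i$, a lower bound $\alpha_i(z)$ and an upper bound $\beta_i(z)\ge\alpha_i(z)$ on the utility. Assume the payoffs are bounded, normalized so that for each player $i$ all values $\alpha_i(z),\beta_i(z)$ lie in an interval of length $1$ (for example $[0,1]$). For a (behavior) strategy profile $\sigma$ of the players let $\alpha_i(\sigma),\beta_i(\sigma)$ be the expected bounds under $\sigma$ and the nature strategy, and let $\beta_i^*(\sigma_{-i})=\max_{\sigma_i'}\beta_i(\sigma_i',\sigma_{-i})$. The profile $\sigma$ is an $\varepsilon$-equilibrium if $\beta_i^*(\sigma_{-i})-\alpha_i(\sigma)\le\varepsilon$ for every $i\in\mathcal P$. Let $D$ be the maximum, over pure strategy profiles of the perfect-information refinement of $\tilde G$ (every information set split into singletons), of the number of leaves reached with positive probability. Let $\varepsilon,\delta>0$. At each nature node $h$ take $n_h$ samples from an i.i.d. sequence with distribution $\sigma_0(\cdot\mid h)$, independently across nodes; each $n_h$ is fixed, or more generally may be chosen from the samples at the nature nodes that are proper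 ancestors of $h$. Let $\hat\sigma_0(\cdot\mid h)$ be the empirical distribution of the samples at $h$ (an arbitrary fixed distribution if $n_h=0$), let $\hat\sigma_0(h)$ be the product of the $\hat\sigma_0$-probabilities of nature's actions on the path to $h$, and let the approximated pseudogame be $\tilde G$ with $\sigma_0$ replaced by $\hat\sigma_0$. Then with probability at least $1-2\delta|\mathcal P|$ over the samples the following holds: if every nature node $h$ was sampled at least $\hat\sigma_0(h)\,\frac{D^2}{2\varepsilon^2}\log\frac{2N}{\delta}$ times, then for every $\varepsilon'\in\mathbb R$, every strategy profile $\sigma$ that is an $\varepsilon'$-equilibrium of the approximated pseudogame is an $(\varepsilon'+2\varepsilon)$-equilibrium of $\tilde G$. -/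

import Mathlib

open MeasureTheory ProbabilityTheory

noncomputable section

/-- `p` is a probability distribution on the finite set `s`
(its values outside `s` are irrelevant). -/
def IsDist {A : Type*} (s : Finset A) (p : A → ℝ) : Prop :=
  (∀ a ∈ s, 0 ≤ p a) ∧ ∑ a ∈ s, p a = 1

/-- A finite game tree with players `P`, action labels `A` and labels `J` for information sets.
A history is the list of the actions taken so far, the most recent action first: the history
`a :: h` is the child of `h` reached by action `a`, and `[]` is the root. -/
structure GameTree (P A J : Type*) where
  /-- the finite set of histories (nodes) -/
  H : Finset (List A)
  root_mem : [] ∈ H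
  mem_of_cons_mem : ∀ a h, a :: h ∈ H → h ∈ H
  /-- the player who acts at a nonterminal node; `none` is nature -/
  player : List A → Option P
  /-- Two decision nodes of the same player lie in the same information set of that player
  iff they carry the same label. -/
  info : List A → J
  /-- the nodes of an information set have the same available actions -/
  info_actions : ∀ h ∈ H, ∀ h' ∈ H, (∃ a, a :: h ∈ H) → (∃ a, a :: h' ∈ H) →
    ∀ i : P, player h = some i → player h' = some i → info h = info h' →
    ∀ a, a :: h ∈ H ↔ a :: h' ∈ H

namespace GameTree

variable {P A J : Type*} (T : GameTree P A J)

/-- The actions available at the node `h`. -/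
def actions (h : List A) : Finset A :=
  T.H.preimage (fun a => a :: h) (fun _ _ _ _ e => (List.cons.inj e).1)

/-- The leaves of the tree. -/
def terminals : Finset (List A) := by
  classical exact T.H.filter (fun h => T.actions h = ∅)

theorem mem_terminals {h : List A} : h ∈ T.terminals ↔ h ∈ T.H ∧ T.actions h = ∅ := by
  unfold terminals
  classical exact Finset.mem_filter

/-- `h` is a nonterminal node at which `j` acts (`none` is nature). -/
def ActsAt (j : Option P) (h : List A) : Prop :=
  h ∈ T.H ∧ T.actions h ≠ ∅ ∧ T.player h = j

/-- The nodes at which nature acts. -/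
def NatureNode : Type _ := {h : List A // T.ActsAt none h}

/-- The actions available at the nature node `h`, as a finite discrete space. -/
def Action (h : T.NatureNode) : Type _ := {a : A // a ∈ T.actions h.1}

instance (h : T.NatureNode) : MeasurableSpace (T.Action h) := ⊤

/-- Strategies of nature: a distribution over the available actions at every nature node. -/
structure NatureStrategy where
  prob : List A → A → ℝ
  isDist : ∀ h, T.ActsAt none h → IsDist (T.actions h) (prob h)

/-- Behavior strategies of player `i`: a distribution over the available actions at every
information set of `i`. -/
structure Strategy (i : P) where
  prob : J → A → ℝ
  isDist : ∀ h, T.ActsAt (some i) h → IsDist (T.actions h) (prob (T.info h))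

/-- Strategy profiles. -/
abbrev Profile : Type _ := ∀ i : P, T.Strategy i

open Classical in
/-- The probability of reaching a node when all actions of `j` are chosen according to `w`
and everybody else plays towards the node. -/
def reachBy (j : Option P) (w : List A → A → ℝ) : List A → ℝ
  | [] => 1
  | a :: h => reachBy j w h * (if T.player h = j then w h a else 1)

variable {T}

/-- Nature's reach probability of `h`. -/
def NatureStrategy.reach (ν : T.NatureStrategy) (h : List A) : ℝ :=
  T.reachBy none ν.prob h

/-- Player `i`'s reach probability of `h`. -/
def Strategy.reach {i : P} (s : T.Strategy i) (h : List A) : ℝ :=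
  T.reachBy (some i) (fun g => s.prob (T.info g)) h

/-- The probability that `h` is reached when the players play `σ` and nature plays `ν`. -/
def reach [Fintype P] (ν : T.NatureStrategy) (σ : T.Profile) (h : List A) : ℝ :=
  ν.reach h * ∏ i, (σ i).reach h

/-- The expectation of the payoff `u` when the players play `σ` and nature plays `ν`. -/
def value [Fintype P] (ν : T.NatureStrategy) (u : List A → ℝ) (σ : T.Profile) : ℝ :=
  ∑ z ∈ T.terminals, reach ν σ z * u z

/-- A strategy that chooses an action deterministically at every information set. -/
def Strategy.IsPure {i : P} (s : T.Strategy i) : Prop :=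
  ∀ h, T.ActsAt (some i) h → ∀ a ∈ T.actions h, s.prob (T.info h) a = 0 ∨ s.prob (T.info h) a = 1

/-- The number of terminal nodes that are reached with positive probability. -/
def supportSize [Fintype P] (ν : T.NatureStrategy) (σ : T.Profile) : ℕ := by
  classical exact (T.terminals.filter (fun z => 0 < reach ν σ z)).card

variable (T)

/-- The perfect-information refinement: the same tree, every information set a singleton. -/
abbrev perfectInfo : GameTree P A (List A) where
  H := T.H
  root_mem := T.root_mem
  mem_of_cons_mem := T.mem_of_cons_mem
  player := T.player
  info := fun h => h
  info_actions := by
    rintro h - h' - - - i - - rfl a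
    exact Iff.rfl

variable {T}

/-- A strategy of nature, seen in the perfect-information refinement. -/
abbrev NatureStrategy.perfectInfo (ν : T.NatureStrategy) : T.perfectInfo.NatureStrategy where
  prob := ν.prob
  isDist := ν.isDist

/-- The maximum support size over terminal nodes of a pure strategy profile in the
perfect-information refinement, when nature plays `ν`. -/
def maxSupport [Fintype P] (ν : T.NatureStrategy) : ℕ :=
  sSup {d | ∃ σ : T.perfectInfo.Profile, (∀ i, (σ i).IsPure) ∧ d = supportSize ν.perfectInfo σ}

open Classical in
/-- The empirical frequencies of the first `n h` samples `x h 0, x h 1, …` at every nature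
node `h`; at an unsampled node the distribution is that of `dflt`. -/
def empirical (dflt : T.NatureStrategy) (x : ∀ h : T.NatureNode, ℕ → T.Action h)
    (n : T.NatureNode → ℕ) : T.NatureStrategy where
  prob := fun h a =>
    if hh : T.ActsAt none h then
      if n ⟨h, hh⟩ = 0 then dflt.prob h a
      else (((Finset.range (n ⟨h, hh⟩)).filter
        (fun k => (x ⟨h, hh⟩ k).1 = a)).card : ℝ) / (n ⟨h, hh⟩ : ℝ)
    else 0
  isDist := by
    intro h hh
    by_cases h0 : n ⟨h, hh⟩ = 0
    · simpa [hh, h0] using dflt.isDist h hh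
    · simp only [hh, dif_pos, h0, if_false]
      refine ⟨fun a _ => by positivity, ?_⟩
      rw [← Finset.sum_div, div_eq_one_iff_eq (by exact_mod_cast h0), ← Nat.cast_sum,
        ← Finset.card_eq_sum_card_fiberwise (fun k _ => (x ⟨h, hh⟩ k).2), Finset.card_range]

end GameTree

/-- A pseudogame: a game in which the utilities at the leaves are only known up to lower
bounds `α` and upper bounds `β`. -/
structure Pseudogame (P A J : Type*) extends GameTree P A J where
  /-- the distributions of nature -/
  nature : toGameTree.NatureStrategy
  α : P → List A → ℝ
  β : P → List A → ℝ
  α_le_β : ∀ i, ∀ z ∈ toGameTree.terminals, α i z ≤ β i z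

namespace Pseudogame

variable {P A J : Type*} (G : Pseudogame P A J)

/-- The pseudogame in which the distributions of nature are replaced by `ν`. -/
abbrev withNature (ν : G.NatureStrategy) : Pseudogame P A J :=
  { G with nature := ν }

open Classical in
/-- The best response value `β i ^*(σ_{-i})` of player `i` for the upper bounds. -/
def bestResponse [Fintype P] (i : P) (σ : G.Profile) : ℝ :=
  ⨆ s : G.Strategy i, GameTree.value G.nature (G.β i) (Function.update σ i s)

/-- `ε`-Nash equilibria of a pseudogame. -/
def IsNash [Fintype P] (ε : ℝ) (σ : G.Profile) : Prop :=
  ∀ i, G.bestResponse i σ - GameTree.value G.nature (G.α i) σ ≤ ε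

end Pseudogame

/-- The σ-algebra generated by the samples at the nature nodes that are proper ancestors
of `h`. -/
abbrev ancestorSamples {P A J Ω : Type*} {T : GameTree P A J}
    (X : ∀ h : T.NatureNode, ℕ → Ω → T.Action h) (h : T.NatureNode) : MeasurableSpace Ω :=
  ⨆ (g : T.NatureNode) (_ : g.1 <:+ h.1 ∧ g.1 ≠ h.1) (k : ℕ), MeasurableSpace.comap (X g k) ⊤

end

/-!
The values of the game and of its approximation are compared on the event that every empirical
frequency at a sampled nature node `h` is within `√(L / (2 n_h))` of the true probability, where
`L = log (2 N / δ)`, and that no sample is an action of probability zero.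

*Probability.* The sample size `n_h` depends only on samples that are independent of those at `h`
(`GameTree.indep_ancestorSamples`), so Hoeffding's inequality for fixed sample sizes applies
(`measureReal_setOf_mem_random_le`), and a single deviation has probability at most
`2 exp (-L) = δ / N`. An action of nature is determined by the node it leads to, so there are at
most `N` of these events, and all of them are avoided with probability at least `1 - δ`. This is at
least the claimed `1 - 2 δ |P|`, unless there are no players, when the claim is vacuous.

*Determinism.* If `n_h ≥ r D² L / (2 ε²)` with `r` the empirical reach of `h`, then the error of a
frequency at `h`, multiplied by `r`, is at most `√r ε / D ≤ ε / D`. For a fixed profile, the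
difference of the two values telescopes along the tree into the errors at the nature nodes, each
weighted by the empirical reach and the players' reach of the node and integrated against the
continuation values of the true game (`GameTree.sum_terminals_pathWeight_mul`). Continuation values
lie in an interval of unit length, so a node with `k` possible actions contributes at most
`(k - 1) ε / D` times the players' reach (`GameTree.abs_sum_sub_mul_le`). The sum of `k - 1`,
weighted by the players' reach, is the expected number of leaves in nature's support minus one,
and this expectation is at most `D` because a deterministic greedy choice at every node maximizes it
(`GameTree.sum_terminals_supp_le_maxSupport`). Hence all values are off by less than `ε`
(`GameTree.abs_value_sub_value_le`), simultaneously for all profiles, and an equilibrium loses at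
most `2 ε` (`Pseudogame.isNash_of_abs_value_sub_le`).
-/

namespace GameTree

variable {P A J : Type*} (T : GameTree P A J)

/-! ### Summation over the tree -/

theorem mem_actions {h : List A} {a : A} : a ∈ T.actions h ↔ a :: h ∈ T.H := by
  unfold actions
  exact Finset.mem_preimage

/-- The decision nodes of the tree, nature's included. -/
noncomputable def inner : Finset (List A) := by
  classical exact T.H.filter (fun h => T.actions h ≠ ∅)

theorem mem_inner {h : List A} : h ∈ T.inner ↔ h ∈ T.H ∧ T.actions h ≠ ∅ := by
  unfold inner
  classical exact Finset.mem_filter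

theorem mem_inner_of_mem_actions {h : List A} {a : A} (ha : a ∈ T.actions h) : h ∈ T.inner :=
  T.mem_inner.2 ⟨T.mem_of_cons_mem a h (T.mem_actions.1 ha), Finset.ne_empty_of_mem ha⟩

theorem sum_H_eq_sum_inner_add_sum_terminals (g : List A → ℝ) :
    ∑ h ∈ T.H, g h = ∑ h ∈ T.inner, g h + ∑ z ∈ T.terminals, g z := by
  classical
  unfold inner terminals
  rw [add_comm]
  exact (Finset.sum_filter_add_sum_filter_not T.H (fun h => T.actions h = ∅) g).symm

/-- Every node but the root is the child of exactly one node. -/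
theorem sum_H_eq_root_add_sum_children (g : List A → ℝ) :
    ∑ h ∈ T.H, g h = g [] + ∑ h ∈ T.H, ∑ a ∈ T.actions h, g (a :: h) := by
  classical
  rw [← Finset.add_sum_erase _ _ T.root_mem, Finset.sum_sigma']
  congr 1
  symm
  refine Finset.sum_bij (fun p _ => p.2 :: p.1) ?_ ?_ ?_ ?_
  · rintro ⟨h, a⟩ hp
    simpa [T.mem_actions] using (Finset.mem_sigma.1 hp).2
  · rintro ⟨h, a⟩ - ⟨h', a'⟩ - e
    obtain ⟨rfl, rfl⟩ := List.cons.inj e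
    rfl
  · rintro (_ | ⟨a, h⟩) hl
    · simp at hl
    · have hl' := Finset.mem_of_mem_erase hl
      exact ⟨⟨h, a⟩, Finset.mem_sigma.2 ⟨T.mem_of_cons_mem a h hl', T.mem_actions.2 hl'⟩, rfl⟩
  · intros; rfl

/-- The product of the weights of the edges on the path from the root to a node. -/
def pathWeight (w : List A → A → ℝ) : List A → ℝ
  | [] => 1
  | a :: h => pathWeight w h * w h a

/-- The sum of a potential over the leaves, telescoped along the tree: it is the value at the root
plus the local defects of harmonicity. -/
theorem sum_terminals_pathWeight_mul (w : List A → A → ℝ) (φ : List A → ℝ) :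
    ∑ z ∈ T.terminals, pathWeight w z * φ z = φ [] +
      ∑ h ∈ T.inner, pathWeight w h * (∑ a ∈ T.actions h, w h a * φ (a :: h) - φ h) := by
  have h1 := T.sum_H_eq_root_add_sum_children (fun h => pathWeight w h * φ h)
  have h2 := T.sum_H_eq_sum_inner_add_sum_terminals (fun h => pathWeight w h * φ h)
  have h3 := T.sum_H_eq_sum_inner_add_sum_terminals
    (fun h => ∑ a ∈ T.actions h, pathWeight w (a :: h) * φ (a :: h))
  have h4 : ∑ z ∈ T.terminals, ∑ a ∈ T.actions z, pathWeight w (a :: z) * φ (a :: z) = 0 :=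
    Finset.sum_eq_zero fun z hz => by rw [(T.mem_terminals.1 hz).2, Finset.sum_empty]
  have h5 : ∑ h ∈ T.inner, pathWeight w h * (∑ a ∈ T.actions h, w h a * φ (a :: h) - φ h) =
      ∑ h ∈ T.inner, ∑ a ∈ T.actions h, pathWeight w (a :: h) * φ (a :: h) -
        ∑ h ∈ T.inner, pathWeight w h * φ h := by
    rw [← Finset.sum_sub_distrib]
    refine Finset.sum_congr rfl fun h _ => ?_
    rw [mul_sub, Finset.mul_sum]
    simp only [pathWeight, mul_assoc]
  simp only [pathWeight, one_mul] at h1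
  simp only [pathWeight] at h3 h4 h5
  linarith

theorem pathWeight_nonneg {w : List A → A → ℝ}
    (hw : ∀ h, ∀ a ∈ T.actions h, 0 ≤ w h a) : ∀ h ∈ T.H, 0 ≤ pathWeight w h
  | [], _ => zero_le_one
  | a :: h, hh => mul_nonneg (pathWeight_nonneg hw h (T.mem_of_cons_mem a h hh))
      (hw h a (T.mem_actions.2 hh))

theorem pathWeight_le_one {w : List A → A → ℝ} (hw : ∀ h, ∀ a ∈ T.actions h, 0 ≤ w h a)
    (hw1 : ∀ h, ∀ a ∈ T.actions h, w h a ≤ 1) : ∀ h ∈ T.H, pathWeight w h ≤ 1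
  | [], _ => le_rfl
  | a :: h, hh => mul_le_one₀ (pathWeight_le_one hw hw1 h (T.mem_of_cons_mem a h hh))
      (hw h a (T.mem_actions.2 hh)) (hw1 h a (T.mem_actions.2 hh))

open Classical in
/-- Rounding positive edge weights up to one rounds positive path weights up to one. -/
theorem pathWeight_eq_ite {w w' : List A → A → ℝ} (hw : ∀ h, ∀ a ∈ T.actions h, 0 ≤ w h a)
    (hw' : ∀ h, ∀ a ∈ T.actions h, w' h a = if 0 < w h a then 1 else 0) :
    ∀ h ∈ T.H, pathWeight w' h = if 0 < pathWeight w h then 1 else 0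
  | [], _ => by simp [pathWeight]
  | a :: h, hh => by
    have hm := T.mem_of_cons_mem a h hh
    have ha := T.mem_actions.2 hh
    have h0 := T.pathWeight_nonneg hw h hm
    rw [pathWeight, pathWeight, pathWeight_eq_ite hw hw' h hm, hw' h a ha]
    rcases h0.eq_or_lt with e | e
    · simp [← e]
    · simp [e]

/-! ### Backward induction -/

/-- Induction from the leaves to the root. -/
theorem backward_induction {p : List A → Prop}
    (hp : ∀ h ∈ T.H, (∀ a ∈ T.actions h, p (a :: h)) → p h) : ∀ h ∈ T.H, p h := by
  have key : ∀ k, ∀ h ∈ T.H, T.H.sup List.length ≤ h.length + k → p h := by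
    intro k
    induction k with
    | zero =>
      intro h hh hk
      refine hp h hh fun a ha => ?_
      have := Finset.le_sup (f := List.length) (T.mem_actions.1 ha)
      simp only [List.length_cons] at this
      omega
    | succ k ih =>
      intro h hh hk
      refine hp h hh fun a ha => ih _ (T.mem_actions.1 ha) ?_
      simp only [List.length_cons]
      omega
  exact fun h hh => key _ h hh (Nat.le_add_left _ _)

/-- Functions on the tree can be defined by recursion from the leaves. -/
theorem exists_backward_recursion (u : List A → ℝ) (F : List A → (A → ℝ) → ℝ) :
    ∃ φ : List A → ℝ, (∀ z ∈ T.terminals, φ z = u z) ∧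
      ∀ h ∈ T.inner, φ h = F h (fun a => φ (a :: h)) := by
  classical
  let v : ℕ → List A → ℝ := fun k => Nat.rec u
    (fun _ f h => if T.actions h = ∅ then u h else F h (fun a => f (a :: h))) k
  refine ⟨fun h => v (T.H.sup List.length - h.length) h, fun z hz => ?_, fun h hh => ?_⟩
  · dsimp only
    rcases T.H.sup List.length - z.length with _ | k
    · rfl
    · exact if_pos (T.mem_terminals.1 hz).2
  · obtain ⟨a, ha⟩ := Finset.nonempty_iff_ne_empty.2 (T.mem_inner.1 hh).2
    have := Finset.le_sup (f := List.length) (T.mem_actions.1 ha)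
    simp only [List.length_cons] at this
    have e : T.H.sup List.length - h.length = T.H.sup List.length - (h.length + 1) + 1 := by
      omega
    simp only [List.length_cons]
    rw [e]
    exact if_neg (T.mem_inner.1 hh).2

/-! ### Reach probabilities as path weights -/

variable {T}

/-- The probability of the edge from `h` to `a :: h` when the players play `σ` and the edges at
nature's nodes carry the weights `p`. -/
def edgeWeight (p : List A → A → ℝ) (σ : T.Profile) (h : List A) (a : A) : ℝ :=
  match T.player h with
  | none => p h a
  | some i => (σ i).prob (T.info h) a

theorem edgeWeight_of_nature {p : List A → A → ℝ} {σ : T.Profile} {h : List A}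
    (hh : T.player h = none) (a : A) : edgeWeight p σ h a = p h a := by
  simp [edgeWeight, hh]

theorem edgeWeight_of_player {p : List A → A → ℝ} {σ : T.Profile} {h : List A} {i : P}
    (hh : T.player h = some i) (a : A) : edgeWeight p σ h a = (σ i).prob (T.info h) a := by
  simp [edgeWeight, hh]

theorem actsAt_of_mem_inner {h : List A} (hh : h ∈ T.inner) : T.ActsAt (T.player h) h :=
  ⟨(T.mem_inner.1 hh).1, (T.mem_inner.1 hh).2, rfl⟩

theorem ActsAt.mem_inner {j : Option P} {h : List A} (hh : T.ActsAt j h) : h ∈ T.inner :=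
  T.mem_inner.2 ⟨hh.1, hh.2.1⟩

theorem reachBy_mul_prod_reach [Fintype P] (p : List A → A → ℝ) (σ : T.Profile) :
    ∀ h, T.reachBy none p h * ∏ i, (σ i).reach h = pathWeight (edgeWeight p σ) h
  | [] => by simp [reachBy, Strategy.reach, pathWeight]
  | a :: h => by
    classical
    rw [pathWeight, ← reachBy_mul_prod_reach p σ h]
    simp only [Strategy.reach, reachBy, Finset.prod_mul_distrib]
    rcases e : T.player h with _ | i
    · simp [edgeWeight_of_nature e]; ring
    · simp [edgeWeight_of_player e, Finset.prod_ite_eq]; ring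

theorem reach_eq_pathWeight [Fintype P] (ν : T.NatureStrategy) (σ : T.Profile) (h : List A) :
    reach ν σ h = pathWeight (edgeWeight ν.prob σ) h :=
  reachBy_mul_prod_reach ν.prob σ h

theorem edgeWeight_nonneg {p : List A → A → ℝ}
    (hp : ∀ h, T.ActsAt none h → ∀ a ∈ T.actions h, 0 ≤ p h a) (σ : T.Profile) (h : List A)
    (a : A) (ha : a ∈ T.actions h) : 0 ≤ edgeWeight p σ h a := by
  have hh := actsAt_of_mem_inner (T.mem_inner_of_mem_actions ha)
  rcases e : T.player h with _ | i
  · rw [edgeWeight_of_nature e]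
    exact hp h (e ▸ hh) a ha
  · rw [edgeWeight_of_player e]
    exact ((σ i).isDist h (e ▸ hh)).1 a ha

theorem isDist_edgeWeight (ν : T.NatureStrategy) (σ : T.Profile) {h : List A}
    (hh : h ∈ T.inner) : IsDist (T.actions h) (edgeWeight ν.prob σ h) := by
  have hh' := actsAt_of_mem_inner hh
  rcases e : T.player h with _ | i
  · rw [funext (edgeWeight_of_nature e)]
    exact ν.isDist h (e ▸ hh')
  · rw [funext (edgeWeight_of_player e)]
    exact (σ i).isDist h (e ▸ hh')

theorem NatureStrategy.prob_nonneg (ν : T.NatureStrategy) (h : List A) (hh : T.ActsAt none h)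
    (a : A) (ha : a ∈ T.actions h) : 0 ≤ ν.prob h a :=
  (ν.isDist h hh).1 a ha

open Classical in
theorem reachBy_eq_pathWeight (j : Option P) (p : List A → A → ℝ) :
    ∀ h, T.reachBy j p h = pathWeight (fun h a => if T.player h = j then p h a else 1) h
  | [] => rfl
  | a :: h => by rw [reachBy, pathWeight, reachBy_eq_pathWeight j p h]

theorem NatureStrategy.reach_nonneg (ν : T.NatureStrategy) {h : List A} (hh : h ∈ T.H) :
    0 ≤ ν.reach h := by
  classical
  rw [NatureStrategy.reach, reachBy_eq_pathWeight]
  refine T.pathWeight_nonneg (fun g a ha => ?_) h hh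
  split_ifs with e
  · exact ν.prob_nonneg g (e ▸ actsAt_of_mem_inner (T.mem_inner_of_mem_actions ha)) a ha
  · exact zero_le_one

theorem NatureStrategy.reach_le_one (ν : T.NatureStrategy) {h : List A} (hh : h ∈ T.H) :
    ν.reach h ≤ 1 := by
  classical
  rw [NatureStrategy.reach, reachBy_eq_pathWeight]
  refine T.pathWeight_le_one (fun g a ha => ?_) (fun g a ha => ?_) h hh <;>
    split_ifs with e
  · exact ν.prob_nonneg g (e ▸ actsAt_of_mem_inner (T.mem_inner_of_mem_actions ha)) a ha
  · exact zero_le_one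
  · have hd := ν.isDist g (e ▸ actsAt_of_mem_inner (T.mem_inner_of_mem_actions ha))
    exact hd.2 ▸ Finset.single_le_sum hd.1 ha
  · exact le_rfl

theorem Strategy.reach_nonneg {i : P} (s : T.Strategy i) {h : List A} (hh : h ∈ T.H) :
    0 ≤ s.reach h := by
  classical
  rw [Strategy.reach, reachBy_eq_pathWeight]
  refine T.pathWeight_nonneg (fun g a ha => ?_) h hh
  split_ifs with e
  · exact (s.isDist g (e ▸ actsAt_of_mem_inner (T.mem_inner_of_mem_actions ha))).1 a ha
  · exact zero_le_one

theorem NatureStrategy.reach_cons_of_nature (ν : T.NatureStrategy) {h : List A}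
    (hh : T.player h = none) (a : A) : ν.reach (a :: h) = ν.reach h * ν.prob h a := by
  simp [NatureStrategy.reach, reachBy, hh]

theorem NatureStrategy.reach_cons_of_player (ν : T.NatureStrategy) {h : List A}
    (hh : T.player h ≠ none) (a : A) : ν.reach (a :: h) = ν.reach h := by
  simp [NatureStrategy.reach, reachBy, hh]

/-! ### The number of leaves in the support -/

open Classical in
/-- The indicator of the actions that nature takes with positive probability. -/
noncomputable def NatureStrategy.supp (ρ : T.NatureStrategy) (h : List A) (a : A) : ℝ :=
  if 0 < ρ.prob h a then 1 else 0

open Classical in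
theorem NatureStrategy.reachBy_supp (ρ : T.NatureStrategy) {h : List A} (hh : h ∈ T.H) :
    T.reachBy none ρ.supp h = if 0 < ρ.reach h then 1 else 0 := by
  rw [NatureStrategy.reach, reachBy_eq_pathWeight, reachBy_eq_pathWeight]
  refine T.pathWeight_eq_ite (fun g a ha => ?_) (fun g a ha => ?_) h hh
  · split_ifs with e
    · exact ρ.prob_nonneg g (e ▸ actsAt_of_mem_inner (T.mem_inner_of_mem_actions ha)) a ha
    · exact zero_le_one
  · by_cases e : T.player g = none <;> simp [e, NatureStrategy.supp]

theorem NatureStrategy.supp_nonneg (ρ : T.NatureStrategy) (h : List A) (a : A) :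
    0 ≤ ρ.supp h a := by
  unfold NatureStrategy.supp
  split_ifs <;> norm_num

theorem bddAbove_supportSize [Fintype P] (ρ : T.NatureStrategy) :
    BddAbove {d | ∃ σ : T.perfectInfo.Profile,
      (∀ i, (σ i).IsPure) ∧ d = supportSize ρ.perfectInfo σ} := by
  refine ⟨T.terminals.card, ?_⟩
  rintro d ⟨σ, -, rfl⟩
  unfold supportSize
  classical exact Finset.card_filter_le _ _

open Classical in
/-- The strategy of the perfect-information refinement that takes the action `b h` at every node
`h` of the player. -/
noncomputable def pureStrategy (b : List A → Option A)
    (hb : ∀ h ∈ T.inner, ∃ a ∈ T.actions h, b h = some a) (i : P) :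
    T.perfectInfo.Strategy i where
  prob := fun h a => if b h = some a then 1 else 0
  isDist := by
    intro h hh
    obtain ⟨c, hc, e⟩ := hb h (ActsAt.mem_inner (T := T) hh)
    refine ⟨fun a _ => by dsimp only; split_ifs <;> norm_num, ?_⟩
    simp only [e, Option.some_inj]
    exact (Finset.sum_ite_eq (T.actions h) c fun _ => (1 : ℝ)).trans (if_pos hc)

/-- In expectation over the players' randomization, at most `maxSupport` leaves of nature's support
are reached, since a greedy deterministic choice at every node maximizes this expectation. -/
theorem sum_terminals_supp_le_maxSupport [Fintype P] (ρ : T.NatureStrategy) (σ : T.Profile) :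
    ∑ z ∈ T.terminals, pathWeight (edgeWeight ρ.supp σ) z ≤ maxSupport ρ := by
  classical
  -- `φ h` is the largest number of leaves below `h` that deterministic play can reach.
  obtain ⟨φ, hφt, hφ⟩ := T.exists_backward_recursion (fun _ => 1) (fun h f =>
    if T.player h = none then ∑ a ∈ T.actions h, ρ.supp h a * f a
    else if hne : (T.actions h).Nonempty then (T.actions h).sup' hne f else 0)
  have hmax : ∀ h, ∃ b : Option A, h ∈ T.inner → ∃ a ∈ T.actions h, b = some a ∧
      ∀ a' ∈ T.actions h, φ (a' :: h) ≤ φ (a :: h) := by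
    intro h
    by_cases hh : h ∈ T.inner
    · obtain ⟨b, hb, hb'⟩ := (T.actions h).exists_max_image (fun a => φ (a :: h))
        (Finset.nonempty_iff_ne_empty.2 (T.mem_inner.1 hh).2)
      exact ⟨some b, fun _ => ⟨b, hb, rfl, hb'⟩⟩
    · exact ⟨none, fun h' => absurd h' hh⟩
  choose b hb using hmax
  have hb' : ∀ h ∈ T.inner, ∃ a ∈ T.actions h, b h = some a := fun h hh =>
    let ⟨a, ha, e, _⟩ := hb h hh
    ⟨a, ha, e⟩
  have hnat : ∀ h ∈ T.inner, T.player h = none →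
      φ h = ∑ a ∈ T.actions h, ρ.supp h a * φ (a :: h) := by
    intro h hh e
    rw [hφ h hh, if_pos e]
  have hpl : ∀ h ∈ T.inner, T.player h ≠ none → ∀ a ∈ T.actions h, b h = some a →
      φ h = φ (a :: h) ∧ ∀ a' ∈ T.actions h, φ (a' :: h) ≤ φ h := by
    intro h hh e a ha e'
    obtain ⟨a₁, -, e₁, hle⟩ := hb h hh
    obtain rfl : a = a₁ := by simpa [e'] using e₁
    have : φ h = φ (a :: h) := by
      rw [hφ h hh, if_neg e, dif_pos ⟨a, ha⟩]
      exact le_antisymm (Finset.sup'_le _ _ hle)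
        (Finset.le_sup' (fun a => φ (a :: h)) ha)
    exact ⟨this, this ▸ hle⟩
  let τ : T.perfectInfo.Profile := pureStrategy b hb'
  have hpure : ∀ i, (τ i).IsPure := by
    intro i h _ a _
    change (if b h = some a then (1 : ℝ) else 0) = 0 ∨ (if b h = some a then (1 : ℝ) else 0) = 1
    split_ifs <;> simp
  have hσ : ∑ z ∈ T.terminals, pathWeight (edgeWeight ρ.supp σ) z ≤ φ [] := by
    have := T.sum_terminals_pathWeight_mul (edgeWeight ρ.supp σ) φ
    rw [Finset.sum_congr rfl fun z hz => by rw [hφt z hz, mul_one]] at this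
    rw [this]
    refine add_le_of_nonpos_right (Finset.sum_nonpos fun h hh => ?_)
    refine mul_nonpos_of_nonneg_of_nonpos (T.pathWeight_nonneg
      (edgeWeight_nonneg (fun h _ a _ => ρ.supp_nonneg h a) σ) h (T.mem_inner.1 hh).1) ?_
    rcases e : T.player h with _ | i
    · simp_rw [edgeWeight_of_nature e, ← hnat h hh e, sub_self, le_refl]
    · obtain ⟨a, ha, e'⟩ := hb' h hh
      have hle := (hpl h hh (by simp [e]) a ha e').2
      have hd := (σ i).isDist h (e ▸ actsAt_of_mem_inner hh)
      simp_rw [edgeWeight_of_player e]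
      rw [sub_nonpos]
      calc ∑ a ∈ T.actions h, (σ i).prob (T.info h) a * φ (a :: h)
          ≤ ∑ a ∈ T.actions h, (σ i).prob (T.info h) a * φ h :=
            Finset.sum_le_sum fun a' h' => mul_le_mul_of_nonneg_left (hle a' h') (hd.1 a' h')
        _ = φ h := by rw [← Finset.sum_mul, hd.2, one_mul]
  have hτ : ∑ z ∈ T.terminals, pathWeight (edgeWeight (T := T.perfectInfo) ρ.supp τ) z = φ [] := by
    have := T.sum_terminals_pathWeight_mul (edgeWeight (T := T.perfectInfo) ρ.supp τ) φ
    rw [Finset.sum_congr rfl fun z hz => by rw [hφt z hz, mul_one]] at this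
    rw [this, Finset.sum_eq_zero, add_zero]
    intro h hh
    rw [sub_eq_zero_of_eq, mul_zero]
    rcases e : T.player h with _ | i
    · simp_rw [edgeWeight_of_nature (T := T.perfectInfo) e, ← hnat h hh e]
    · obtain ⟨a, ha, e'⟩ := hb' h hh
      simp_rw [edgeWeight_of_player (T := T.perfectInfo) e]
      change ∑ a' ∈ T.actions h, (if b h = some a' then (1 : ℝ) else 0) * φ (a' :: h) = φ h
      rw [(hpl h hh (by simp [e]) a ha e').1, Finset.sum_eq_single a]
      · simp [e']
      · intro a' _ hne
        rw [e', if_neg (by simpa using hne.symm), zero_mul]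
      · exact fun h' => absurd ha h'
  have hcard : ∑ z ∈ T.terminals, pathWeight (edgeWeight (T := T.perfectInfo) ρ.supp τ) z =
      supportSize ρ.perfectInfo τ := by
    unfold supportSize
    rw [Finset.natCast_card_filter]
    refine Finset.sum_congr rfl fun z hz => ?_
    rw [reach_eq_pathWeight]
    refine T.pathWeight_eq_ite (edgeWeight_nonneg (T := T.perfectInfo) ρ.prob_nonneg τ)
      (fun h a ha => ?_) z (T.mem_terminals.1 hz).1
    rcases e : T.player h with _ | i
    · simp only [edgeWeight_of_nature (T := T.perfectInfo) e]
      rfl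
    · simp only [edgeWeight_of_player (T := T.perfectInfo) e]
      change (if b h = some a then (1 : ℝ) else 0) =
        if 0 < (if b h = some a then (1 : ℝ) else 0) then 1 else 0
      by_cases hba : b h = some a <;> simp [hba]
  rw [← hτ, hcard] at hσ
  exact hσ.trans (Nat.cast_le.2 (le_csSup (bddAbove_supportSize ρ) ⟨τ, hpure, rfl⟩))

/-- A node with `k` children splits off `k - 1` additional paths, so the total of `k - 1` over the
decision nodes is the number of leaves minus one. Players contribute nothing, since their
probabilities sum to one; at nature's nodes `k` counts the actions of positive probability. -/
theorem sum_inner_branching_le [Fintype P] (ρ : T.NatureStrategy) (σ : T.Profile) :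
    ∑ h ∈ T.inner, pathWeight (edgeWeight ρ.supp σ) h *
      (∑ a ∈ T.actions h, edgeWeight ρ.supp σ h a - 1) ≤ maxSupport ρ - 1 := by
  have h1 := T.sum_terminals_pathWeight_mul (edgeWeight ρ.supp σ) (fun _ => 1)
  have h2 := sum_terminals_supp_le_maxSupport ρ σ
  simp only [mul_one] at h1
  linarith

theorem NatureStrategy.one_le_sum_supp (ρ : T.NatureStrategy) {h : List A}
    (hh : T.ActsAt none h) : 1 ≤ ∑ a ∈ T.actions h, ρ.supp h a := by
  obtain ⟨hn, hs⟩ := ρ.isDist h hh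
  rw [← hs]
  refine Finset.sum_le_sum fun a ha => ?_
  unfold NatureStrategy.supp
  split_ifs with h0
  · exact hs ▸ Finset.single_le_sum hn ha
  · exact not_lt.1 h0

theorem sum_edgeWeight_supp_sub_one_nonneg (ρ : T.NatureStrategy) (σ : T.Profile) {h : List A}
    (hh : h ∈ T.inner) : 0 ≤ ∑ a ∈ T.actions h, edgeWeight ρ.supp σ h a - 1 := by
  have hh' := actsAt_of_mem_inner hh
  rcases e : T.player h with _ | i
  · simp_rw [edgeWeight_of_nature e]
    linarith [ρ.one_le_sum_supp (e ▸ hh')]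
  · simp_rw [edgeWeight_of_player e, ((σ i).isDist h (e ▸ hh')).2, sub_self, le_refl]

theorem one_le_maxSupport [Fintype P] (ρ : T.NatureStrategy) (σ : T.Profile) :
    (1 : ℝ) ≤ maxSupport ρ := by
  refine sub_nonneg.1 (le_trans (Finset.sum_nonneg fun h hh => ?_) (sum_inner_branching_le ρ σ))
  exact mul_nonneg (T.pathWeight_nonneg (edgeWeight_nonneg (fun h _ a _ => ρ.supp_nonneg h a) σ) h
    (T.mem_inner.1 hh).1) (sum_edgeWeight_supp_sub_one_nonneg ρ σ hh)

/-! ### Sensitivity of the value to nature's strategy -/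

/-- Two distributions that differ by at most `η` at each point integrate a function with values in
an interval of unit length to within `η (k - 1)` of each other, where `k` is the size of the common
support: the difference is at most `η k / 2`, and it vanishes when `k = 1`. -/
theorem abs_sum_sub_mul_le {s : Finset A} {p q f : A → ℝ} (hp : IsDist s p) (hq : IsDist s q)
    {c η k : ℝ} (hf : ∀ a ∈ s, c ≤ f a ∧ f a ≤ c + 1) (hη : ∀ a ∈ s, k * |p a - q a| ≤ η)
    (hk : 0 ≤ k) (h0 : ∀ a ∈ s, q a = 0 → p a = 0) :
    k * |∑ a ∈ s, (p a - q a) * f a| ≤ η * (∑ a ∈ s, (if 0 < q a then (1 : ℝ) else 0) - 1) := by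
  classical
  set S := s.filter (fun a => 0 < q a) with hS
  have hcard : ∑ a ∈ s, (if 0 < q a then (1 : ℝ) else 0) = S.card := by
    rw [hS, Finset.natCast_card_filter]
  have hout : ∀ a ∈ s, a ∉ S → p a = 0 ∧ q a = 0 := by
    intro a ha hn
    have : q a = 0 := le_antisymm (not_lt.1 fun h => hn (Finset.mem_filter.2 ⟨ha, h⟩)) (hq.1 a ha)
    exact ⟨h0 a ha this, this⟩
  have hSs : S ⊆ s := Finset.filter_subset _ _
  have hpS : ∑ a ∈ S, p a = 1 := by
    rw [Finset.sum_subset hSs fun a ha hn => (hout a ha hn).1, hp.2]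
  have hqS : ∑ a ∈ S, q a = 1 := by
    rw [Finset.sum_subset hSs fun a ha hn => (hout a ha hn).2, hq.2]
  have hfS : ∑ a ∈ s, (p a - q a) * f a = ∑ a ∈ S, (p a - q a) * (f a - (c + 1 / 2)) := by
    -- Since `p - q` has sum zero, the values can be centred at the middle of their interval.
    rw [← Finset.sum_subset hSs fun a ha hn => by rw [(hout a ha hn).1, (hout a ha hn).2]; simp]
    simp_rw [mul_sub]
    rw [Finset.sum_sub_distrib, ← Finset.sum_mul, Finset.sum_sub_distrib, hpS, hqS]
    simp
  rw [hcard, hfS]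
  have hne : S.Nonempty := by
    by_contra hne
    rw [Finset.not_nonempty_iff_eq_empty.1 hne] at hpS
    simp at hpS
  rcases (Finset.one_le_card.2 hne).eq_or_lt with h1 | h1
  · obtain ⟨a, ha⟩ := Finset.card_eq_one.1 h1.symm
    rw [ha, Finset.sum_singleton] at hpS hqS
    rw [← h1, ha]
    simp [hpS, hqS]
  · have h2 : (2 : ℝ) ≤ S.card := by exact_mod_cast h1
    have hη0 : 0 ≤ η := by
      obtain ⟨a, ha⟩ := hne
      exact (mul_nonneg hk (abs_nonneg _)).trans (hη a (hSs ha))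
    calc k * |∑ a ∈ S, (p a - q a) * (f a - (c + 1 / 2))|
        ≤ k * ∑ a ∈ S, |p a - q a| * (1 / 2) := by
          refine mul_le_mul_of_nonneg_left ((Finset.abs_sum_le_sum_abs _ _).trans
            (Finset.sum_le_sum fun a ha => ?_)) hk
          rw [abs_mul]
          refine mul_le_mul_of_nonneg_left (abs_le.2 ?_) (abs_nonneg _)
          constructor <;> linarith [hf a (hSs ha)]
      _ = (∑ a ∈ S, k * |p a - q a|) * (1 / 2) := by
          rw [← Finset.sum_mul, ← Finset.mul_sum, mul_assoc]
      _ ≤ (S.card * η) * (1 / 2) := by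
          refine mul_le_mul_of_nonneg_right ?_ (by norm_num)
          rw [← nsmul_eq_mul]
          exact Finset.sum_le_card_nsmul _ _ _ fun a ha => hη a (hSs ha)
      _ ≤ η * (S.card - 1) := by nlinarith

/-- Where `ν` is absolutely continuous with respect to `ρ` at all nodes that it reaches, it only
reaches nodes that `ρ` reaches. -/
theorem NatureStrategy.reach_pos_of_reach_pos {ν ρ : T.NatureStrategy}
    (h0 : ∀ h, T.ActsAt none h → 0 < ν.reach h → ∀ a ∈ T.actions h,
      ρ.prob h a = 0 → ν.prob h a = 0) :
    ∀ h ∈ T.H, 0 < ν.reach h → 0 < ρ.reach h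
  | [], _, _ => zero_lt_one
  | a :: h, hh, hpos => by
    have hm := T.mem_of_cons_mem a h hh
    have ha := T.mem_actions.2 hh
    by_cases e : T.player h = none
    · have hacts : T.ActsAt none h := e ▸ actsAt_of_mem_inner (T.mem_inner_of_mem_actions ha)
      rw [reach_cons_of_nature ν e] at hpos
      rw [reach_cons_of_nature ρ e]
      have hν : 0 < ν.reach h := lt_of_le_of_ne (ν.reach_nonneg hm) fun h' => by
        simp [← h'] at hpos
      refine mul_pos (reach_pos_of_reach_pos h0 h hm hν)
        (lt_of_le_of_ne (ρ.prob_nonneg h hacts a ha) fun h' => ?_)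
      simp [h0 h hacts hν a ha h'.symm] at hpos
    · rw [reach_cons_of_player ν e] at hpos
      rw [reach_cons_of_player ρ e]
      exact reach_pos_of_reach_pos h0 h hm hpos

theorem value_mem_Icc [Fintype P] (ν : T.NatureStrategy) (σ : T.Profile) {u : List A → ℝ} {c : ℝ}
    (hu : ∀ z ∈ T.terminals, c ≤ u z ∧ u z ≤ c + 1) :
    c ≤ value ν u σ ∧ value ν u σ ≤ c + 1 := by
  have hconst : ∀ d : ℝ, ∑ z ∈ T.terminals, reach ν σ z * d = d := by
    intro d
    simp_rw [reach_eq_pathWeight]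
    rw [T.sum_terminals_pathWeight_mul (edgeWeight ν.prob σ) (fun _ => d), Finset.sum_eq_zero,
      add_zero]
    intro h hh
    rw [← Finset.sum_mul, (isDist_edgeWeight ν σ hh).2, one_mul, sub_self, mul_zero]
  have hnn : ∀ z ∈ T.terminals, 0 ≤ reach ν σ z := fun z hz => by
    rw [reach_eq_pathWeight]
    exact T.pathWeight_nonneg (edgeWeight_nonneg ν.prob_nonneg σ) z (T.mem_terminals.1 hz).1
  unfold value
  constructor
  · calc c = ∑ z ∈ T.terminals, reach ν σ z * c := (hconst c).symm
      _ ≤ _ := Finset.sum_le_sum fun z hz => mul_le_mul_of_nonneg_left (hu z hz).1 (hnn z hz)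
  · calc _ ≤ ∑ z ∈ T.terminals, reach ν σ z * (c + 1) :=
          Finset.sum_le_sum fun z hz => mul_le_mul_of_nonneg_left (hu z hz).2 (hnn z hz)
      _ = c + 1 := hconst _

/-- If the reach-weighted errors of nature's probabilities are at most `η`, all values are off by at
most `η (D - 1)`. The difference of the values telescopes into the errors made at the single nature
nodes, measured on the continuation values under `ρ`; a node with `k` branches contributes at most
`η (k - 1)`, and the total number of branchings is below `D`. -/
theorem abs_value_sub_value_le [Fintype P] {ν ρ : T.NatureStrategy} (σ : T.Profile)
    {u : List A → ℝ} {c η : ℝ} (hη0 : 0 ≤ η) (hu : ∀ z ∈ T.terminals, c ≤ u z ∧ u z ≤ c + 1)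
    (hη : ∀ h, T.ActsAt none h → ∀ a ∈ T.actions h,
      ν.reach h * |ν.prob h a - ρ.prob h a| ≤ η)
    (h0 : ∀ h, T.ActsAt none h → 0 < ν.reach h → ∀ a ∈ T.actions h,
      ρ.prob h a = 0 → ν.prob h a = 0) :
    |value ν u σ - value ρ u σ| ≤ η * (maxSupport ρ - 1) := by
  classical
  -- `φ` is the continuation value when nature plays `ρ`.
  obtain ⟨φ, hφt, hφ⟩ := T.exists_backward_recursion u (fun h f =>
    ∑ a ∈ T.actions h, edgeWeight ρ.prob σ h a * f a)
  have hφc : ∀ h ∈ T.H, c ≤ φ h ∧ φ h ≤ c + 1 := by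
    refine T.backward_induction fun h hh ih => ?_
    by_cases hi : h ∈ T.inner
    · have hd := isDist_edgeWeight ρ σ hi
      rw [hφ h hi]
      constructor
      · calc c = ∑ a ∈ T.actions h, edgeWeight ρ.prob σ h a * c := by
              rw [← Finset.sum_mul, hd.2, one_mul]
          _ ≤ _ := Finset.sum_le_sum fun a ha =>
            mul_le_mul_of_nonneg_left (ih a ha).1 (hd.1 a ha)
      · calc _ ≤ ∑ a ∈ T.actions h, edgeWeight ρ.prob σ h a * (c + 1) :=
              Finset.sum_le_sum fun a ha => mul_le_mul_of_nonneg_left (ih a ha).2 (hd.1 a ha)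
          _ = c + 1 := by rw [← Finset.sum_mul, hd.2, one_mul]
    · have hz : h ∈ T.terminals := T.mem_terminals.2
        ⟨hh, not_not.1 fun h' => hi (T.mem_inner.2 ⟨hh, h'⟩)⟩
      rw [hφt h hz]
      exact hu h hz
  have hval : ∀ κ : T.NatureStrategy, value κ u σ = φ [] + ∑ h ∈ T.inner,
      pathWeight (edgeWeight κ.prob σ) h *
        (∑ a ∈ T.actions h, (edgeWeight κ.prob σ h a - edgeWeight ρ.prob σ h a) *
          φ (a :: h)) := by
    intro κ
    unfold value
    simp_rw [reach_eq_pathWeight]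
    rw [Finset.sum_congr rfl fun z hz => by rw [← hφt z hz], T.sum_terminals_pathWeight_mul]
    congr 1
    refine Finset.sum_congr rfl fun h hh => ?_
    rw [hφ h hh, ← Finset.sum_sub_distrib]
    simp_rw [sub_mul]
  have hρ : value ρ u σ = φ [] := by
    rw [hval ρ]
    simp
  rw [hρ, hval ν, add_sub_cancel_left]
  refine (Finset.abs_sum_le_sum_abs _ _).trans (le_trans ?_
    (mul_le_mul_of_nonneg_left (sum_inner_branching_le ρ σ) hη0))
  rw [Finset.mul_sum]
  refine Finset.sum_le_sum fun h hh => ?_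
  have hH := (T.mem_inner.1 hh).1
  have hacts := actsAt_of_mem_inner hh
  have hσ0 : 0 ≤ ∏ i, (σ i).reach h := Finset.prod_nonneg fun i _ => (σ i).reach_nonneg hH
  have hb0 := sum_edgeWeight_supp_sub_one_nonneg ρ σ hh
  rw [abs_mul, ← reach_eq_pathWeight, ← reachBy_mul_prod_reach ρ.supp, reach, abs_mul,
    abs_of_nonneg (ν.reach_nonneg hH), abs_of_nonneg hσ0, ρ.reachBy_supp hH]
  rcases e : T.player h with _ | i
  · rw [e] at hacts
    simp_rw [edgeWeight_of_nature e] at hb0 ⊢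
    rcases (ν.reach_nonneg hH).eq_or_lt with hr | hr
    · rw [← hr]
      simp only [zero_mul]
      split_ifs <;> positivity
    · rw [if_pos (NatureStrategy.reach_pos_of_reach_pos h0 h hH hr)]
      have := abs_sum_sub_mul_le (ν.isDist h hacts) (ρ.isDist h hacts)
        (fun a ha => hφc _ (T.mem_actions.1 ha)) (hη h hacts) hr.le (h0 h hacts hr)
      calc _ = (∏ i, (σ i).reach h) * (ν.reach h *
            |∑ a ∈ T.actions h, (ν.prob h a - ρ.prob h a) * φ (a :: h)|) := by ring
        _ ≤ _ := mul_le_mul_of_nonneg_left this hσ0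
        _ = _ := by
          unfold NatureStrategy.supp
          ring
  · simp_rw [edgeWeight_of_player e] at hb0 ⊢
    simp only [sub_self, zero_mul, Finset.sum_const_zero, abs_zero, mul_zero]
    split_ifs <;> positivity

end GameTree

/-! ### Concentration of the empirical frequencies -/

/-- **Hoeffding's inequality** for the frequency of an event in independent samples of a law, at the
deviation whose probability is `2 * exp (-L)`. -/
theorem measureReal_abs_freq_sub_ge_le {Ω S : Type*} [MeasurableSpace Ω] {μ : Measure Ω}
    [IsProbabilityMeasure μ] [MeasurableSpace S] {X : ℕ → Ω → S} (hX : ∀ k, Measurable (X k))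
    (hindep : iIndepFun X μ) {B : Set S} (hB : MeasurableSet B) {p : ℝ}
    (hp : ∀ k, μ.real (X k ⁻¹' B) = p) {L : ℝ} (hL : 0 ≤ L) {m : ℕ} (hm : 0 < m) :
    μ.real {ω | √(L / (2 * m)) ≤
      |(∑ k ∈ Finset.range m, B.indicator (fun _ => (1 : ℝ)) (X k ω)) / m - p|} ≤
        2 * Real.exp (-L) := by
  have hm' : (0 : ℝ) < m := Nat.cast_pos.2 hm
  have hmeas : Measurable (B.indicator (fun _ => (1 : ℝ))) := measurable_const.indicator hB
  have hYm : ∀ k, Measurable fun ω => B.indicator (fun _ => (1 : ℝ)) (X k ω) :=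
    fun k => hmeas.comp (hX k)
  have hint : ∀ k, μ[fun ω => B.indicator (fun _ => (1 : ℝ)) (X k ω)] = p := by
    intro k
    have : (fun ω => B.indicator (fun _ => (1 : ℝ)) (X k ω)) = (X k ⁻¹' B).indicator 1 := by
      ext ω
      by_cases h : X k ω ∈ B <;> simp [h]
    rw [this, integral_indicator_one (hX k hB), hp k]
  have hsub : ∀ k, HasSubgaussianMGF
      (fun ω => B.indicator (fun _ => (1 : ℝ)) (X k ω) - p) ((‖(1 : ℝ) - 0‖₊ / 2) ^ 2) μ := by
    intro k
    have := hasSubgaussianMGF_of_mem_Icc (a := 0) (b := 1) (hYm k).aemeasurable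
      (μ := μ) (Filter.Eventually.of_forall fun ω => by
        by_cases h : X k ω ∈ B <;> simp [h])
    rwa [hint k] at this
  have hind : iIndepFun (fun k ω => B.indicator (fun _ => (1 : ℝ)) (X k ω) - p) μ :=
    hindep.comp (fun _ s => B.indicator (fun _ => (1 : ℝ)) s - p) fun _ => hmeas.sub_const p
  have hind' : iIndepFun (fun k ω => -(B.indicator (fun _ => (1 : ℝ)) (X k ω) - p)) μ :=
    hind.comp (fun _ x => -x) fun _ => measurable_neg
  -- An indicator has sub-Gaussian variance proxy `1 / 4`.
  set t := √(L / (2 * m)) with ht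
  have ht2 : t ^ 2 = L / (2 * m) := Real.sq_sqrt (by positivity)
  have hexp : -(m * t) ^ 2 / (2 * m * (((‖(1 : ℝ) - 0‖₊ / 2) ^ 2 : NNReal) : ℝ)) = -L := by
    rw [mul_pow, ht2]
    norm_num
    field_simp
    norm_num
  have h1 := HasSubgaussianMGF.measure_sum_range_ge_le_of_iIndepFun hind (n := m)
    (fun k _ => hsub k) (ε := m * t) (by positivity)
  have h2 := HasSubgaussianMGF.measure_sum_range_ge_le_of_iIndepFun hind' (n := m)
    (fun k _ => (hsub k).neg) (ε := m * t) (by positivity)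
  rw [hexp] at h1 h2
  refine (measureReal_mono ?_).trans ((measureReal_union_le _ _).trans
    ((add_le_add h1 h2).trans (two_mul _).ge))
  intro ω hω
  have hω' : m * t ≤ |∑ k ∈ Finset.range m, B.indicator (fun _ => (1 : ℝ)) (X k ω) - m * p| := by
    calc m * t ≤ m * |(∑ k ∈ Finset.range m, B.indicator (fun _ => (1 : ℝ)) (X k ω)) / m - p| :=
          mul_le_mul_of_nonneg_left hω hm'.le
      _ = _ := by
        rw [← abs_of_pos hm', ← abs_mul, abs_of_pos hm', mul_sub, mul_div_cancel₀ _ hm'.ne']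
  rcases le_abs.1 hω' with h | h
  · left
    simpa [Finset.sum_sub_distrib] using h
  · right
    simpa [Finset.sum_sub_distrib] using h

/-- A bound on the probabilities that holds for every fixed index holds for a random index that is
independent of the events. -/
theorem measureReal_setOf_mem_random_le {Ω : Type*} {m₁ m₂ : MeasurableSpace Ω}
    [m0 : MeasurableSpace Ω] {μ : Measure Ω} [IsProbabilityMeasure μ] (h₁ : m₁ ≤ m0)
    (hind : Indep m₁ m₂ μ) {n : Ω → ℕ} (hn : Measurable[m₁] n) {B : ℕ → Set Ω}
    (hB : ∀ m, MeasurableSet[m₂] (B m)) {b : ℝ} (hb0 : 0 ≤ b) (hb : ∀ m, μ.real (B m) ≤ b) :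
    μ.real {ω | ω ∈ B (n ω)} ≤ b := by
  have hb' : ∀ m, μ (B m) ≤ ENNReal.ofReal b := fun m => by
    rw [← ofReal_measureReal]
    exact ENNReal.ofReal_le_ofReal (hb m)
  refine ENNReal.toReal_le_of_le_ofReal hb0 ?_
  have hE : {ω | ω ∈ B (n ω)} = ⋃ m, n ⁻¹' {m} ∩ B m := by
    ext ω
    simp
  calc μ {ω | ω ∈ B (n ω)} ≤ ∑' m, μ (n ⁻¹' {m} ∩ B m) := hE ▸ measure_iUnion_le _
    _ = ∑' m, μ (n ⁻¹' {m}) * μ (B m) := by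
      refine tsum_congr fun m => ?_
      exact (Indep_iff _ _ _).1 hind _ _ (hn (measurableSet_singleton m)) (hB m)
    _ ≤ ∑' m, μ (n ⁻¹' {m}) * ENNReal.ofReal b := by
      gcongr with m
      exact hb' m
    _ = ENNReal.ofReal b := by
      rw [ENNReal.tsum_mul_right, ← measure_iUnion, ← Set.preimage_iUnion]
      · rw [Set.iUnion_of_singleton, Set.preimage_univ, measure_univ, one_mul]
      · intro i j hij
        exact (Set.disjoint_singleton.2 hij).preimage n
      · exact fun m => h₁ _ (hn (measurableSet_singleton m))

namespace GameTree

variable {P A J Ω : Type*} {T : GameTree P A J}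

theorem measurableSet_action {h : T.NatureNode} (s : Set (T.Action h)) : MeasurableSet s :=
  MeasurableSpace.measurableSet_top

/-- The samples at a nature node are independent of those at its proper ancestors. -/
theorem indep_ancestorSamples [MeasurableSpace Ω] {μ : Measure Ω}
    {X : ∀ h : T.NatureNode, ℕ → Ω → T.Action h} (hX : ∀ h k, Measurable (X h k))
    (hindep : iIndepFun (fun p : T.NatureNode × ℕ => X p.1 p.2) μ) (h : T.NatureNode) :
    Indep (ancestorSamples X h) (⨆ k, MeasurableSpace.comap (X h k) ⊤) μ := by
  have := indep_iSup_of_disjoint (fun p : T.NatureNode × ℕ => (hX p.1 p.2).comap_le) hindep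
    (S := {p | p.1 ≠ h}) (T := {p | p.1 = h})
    (Set.disjoint_left.2 fun p h1 h2 => h1 h2)
  refine indep_of_indep_of_le_left (indep_of_indep_of_le_right this ?_) ?_
  · exact iSup_le fun k => le_iSup₂_of_le (h, k) rfl le_rfl
  · refine iSup_le fun g => iSup_le fun hg => iSup_le fun k => ?_
    exact le_iSup₂_of_le (g, k) (fun e => hg.2 (congrArg Subtype.val e)) le_rfl

theorem ancestorSamples_le [m0 : MeasurableSpace Ω]
    {X : ∀ h : T.NatureNode, ℕ → Ω → T.Action h} (hX : ∀ h k, Measurable (X h k))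
    (h : T.NatureNode) : ancestorSamples X h ≤ m0 :=
  iSup_le fun g => iSup_le fun _ => iSup_le fun k => (hX g k).comap_le

theorem empirical_prob_of_ne_zero (dflt : T.NatureStrategy)
    (x : ∀ h : T.NatureNode, ℕ → T.Action h) {n : T.NatureNode → ℕ} (h : T.NatureNode)
    (hn : n h ≠ 0) (a : T.Action h) : (empirical dflt x n).prob h.1 a.1 =
      (∑ k ∈ Finset.range (n h), ({a} : Set (T.Action h)).indicator (fun _ => (1 : ℝ)) (x h k)) /
        n h := by
  classical
  have hne : n ⟨h.1, h.2⟩ ≠ 0 := hn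
  simp only [empirical, dif_pos h.2, if_neg hne]
  rw [Finset.natCast_card_filter]
  congr 1
  refine Finset.sum_congr rfl fun k _ => ?_
  by_cases e : x h k = a
  · exact (if_pos (congrArg Subtype.val e)).trans (by simp [e])
  · exact (if_neg fun e' => e (Subtype.ext e')).trans (by simp [e])

/-- At a nature node and for one of its actions, the empirical frequency misses the probability by
at least the Hoeffding deviation, or the action is sampled although its probability is zero. -/
def BadEvent (ρ : T.NatureStrategy) (X : ∀ h : T.NatureNode, ℕ → Ω → T.Action h)
    (n : T.NatureNode → Ω → ℕ) (L : ℝ) (h : T.NatureNode) (a : T.Action h) : Set Ω :=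
  {ω | 0 < n h ω ∧ √(L / (2 * n h ω)) ≤ |(∑ k ∈ Finset.range (n h ω),
    ({a} : Set (T.Action h)).indicator (fun _ => (1 : ℝ)) (X h k ω)) / n h ω - ρ.prob h.1 a.1|} ∪
  {ω | ρ.prob h.1 a.1 = 0 ∧ ∃ k, X h k ω = a}

theorem measureReal_badEvent_le [MeasurableSpace Ω] {μ : Measure Ω} [IsProbabilityMeasure μ]
    {ρ : T.NatureStrategy} {X : ∀ h : T.NatureNode, ℕ → Ω → T.Action h}
    (hX : ∀ h k, Measurable (X h k))
    (hlaw : ∀ h k (a : T.Action h), μ.real (X h k ⁻¹' {a}) = ρ.prob h.1 a.1)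
    (hindep : iIndepFun (fun p : T.NatureNode × ℕ => X p.1 p.2) μ) {n : T.NatureNode → Ω → ℕ}
    (hn : ∀ h, Measurable[ancestorSamples X h] (n h)) {L : ℝ} (hL : 0 ≤ L) (h : T.NatureNode)
    (a : T.Action h) : μ.real (BadEvent ρ X n L h a) ≤ 2 * Real.exp (-L) := by
  have hnull : μ.real {ω | ρ.prob h.1 a.1 = 0 ∧ ∃ k, X h k ω = a} = 0 := by
    rw [measureReal_eq_zero_iff]
    by_cases h0 : ρ.prob h.1 a.1 = 0
    · have : {ω | ρ.prob h.1 a.1 = 0 ∧ ∃ k, X h k ω = a} = ⋃ k, X h k ⁻¹' {a} := by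
        ext ω
        simp [h0]
      rw [this, measure_iUnion_null_iff]
      intro k
      rw [← measureReal_eq_zero_iff, hlaw, h0]
    · simp [h0]
  refine (measureReal_union_le _ _).trans ?_
  rw [hnull, add_zero]
  have hindh : iIndepFun (X h) μ :=
    hindep.precomp (g := fun k => (h, k)) fun _ _ e => (Prod.mk.inj e).2
  refine measureReal_setOf_mem_random_le (m₂ := ⨆ k, MeasurableSpace.comap (X h k) ⊤)
    (ancestorSamples_le hX h) (indep_ancestorSamples hX hindep h) (hn h)
    (B := fun m => {ω | 0 < m ∧ √(L / (2 * m)) ≤ |(∑ k ∈ Finset.range m,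
      ({a} : Set (T.Action h)).indicator (fun _ => (1 : ℝ)) (X h k ω)) / m - ρ.prob h.1 a.1|})
    (fun m => ?_) (by positivity) fun m => ?_
  · let _ : MeasurableSpace Ω := ⨆ k, MeasurableSpace.comap (X h k) ⊤
    have hXk : ∀ k, Measurable (X h k) := fun k =>
      measurable_iff_comap_le.2 (le_iSup (fun k => MeasurableSpace.comap (X h k) ⊤) k)
    have hs : Measurable fun ω => |(∑ k ∈ Finset.range m,
        ({a} : Set (T.Action h)).indicator (fun _ => (1 : ℝ)) (X h k ω)) / m -
          ρ.prob h.1 a.1| := by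
      refine ((Measurable.div_const (Finset.measurable_sum _ fun k _ => ?_) _).sub_const _).abs
      exact (measurable_const.indicator (measurableSet_action _)).comp (hXk k)
    exact (MeasurableSet.const _).inter (measurableSet_le measurable_const hs)
  · rcases Nat.eq_zero_or_pos m with rfl | hm
    · simp [Real.exp_nonneg]
    · simp only [hm, true_and]
      exact measureReal_abs_freq_sub_ge_le (hX h) hindh (measurableSet_action _)
        (fun k => hlaw h k a) hL hm

/-- Every action of nature is determined by the node it leads to. -/
theorem injective_child_of_nature : Function.Injective
    fun p : Σ h : T.NatureNode, T.Action h =>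
      (⟨p.2.1 :: p.1.1, T.mem_actions.1 p.2.2⟩ : T.H) := by
  rintro ⟨⟨h, hh⟩, ⟨a, ha⟩⟩ ⟨⟨h', hh'⟩, ⟨a', ha'⟩⟩ e
  obtain ⟨rfl, rfl⟩ := List.cons.inj (Subtype.mk.inj e)
  rfl

instance : Finite (Σ h : T.NatureNode, T.Action h) :=
  Finite.of_injective _ injective_child_of_nature

theorem card_natureActions_le [Fintype (Σ h : T.NatureNode, T.Action h)] :
    Fintype.card (Σ h : T.NatureNode, T.Action h) ≤ T.H.card := by
  rw [← Fintype.card_coe]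
  exact Fintype.card_le_of_injective _ injective_child_of_nature

/-- Outside the bad events, sample sizes proportional to the empirical reach make the
reach-weighted errors at most `ε / D`. -/
theorem reach_mul_abs_empirical_sub_le {ρ dflt : T.NatureStrategy}
    {X : ∀ h : T.NatureNode, ℕ → Ω → T.Action h} {n : T.NatureNode → Ω → ℕ} {L ε D : ℝ}
    (hL : 0 < L) (hε : 0 < ε) (hD : 0 < D) {ω : Ω}
    {ν : T.NatureStrategy} (hν : ν = empirical dflt (fun h k => X h k ω) (fun h => n h ω))
    (h : T.NatureNode) (hsize : ν.reach h.1 * (D ^ 2 / (2 * ε ^ 2)) * L ≤ n h ω)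
    (a : T.Action h) (hω : ω ∉ BadEvent ρ X n L h a) :
    ν.reach h.1 * |ν.prob h.1 a.1 - ρ.prob h.1 a.1| ≤ ε / D ∧
      (0 < ν.reach h.1 → ρ.prob h.1 a.1 = 0 → ν.prob h.1 a.1 = 0) := by
  have hr0 : 0 ≤ ν.reach h.1 := ν.reach_nonneg h.2.1
  have hr1 : ν.reach h.1 ≤ 1 := ν.reach_le_one h.2.1
  -- An unreached node may be unsampled; its empirical distribution then has no weight.
  rcases hr0.eq_or_lt with hr | hr
  · rw [← hr, zero_mul]
    exact ⟨by positivity, fun h' => absurd h' (lt_irrefl 0)⟩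
  have hnpos : (0 : ℝ) < n h ω := lt_of_lt_of_le (by positivity) hsize
  have hn0 : 0 < n h ω := Nat.cast_pos.1 hnpos
  have hprob := empirical_prob_of_ne_zero dflt (fun h k => X h k ω) (n := fun h => n h ω) h
    hn0.ne' a
  rw [← hν] at hprob
  simp only [BadEvent, Set.mem_union, Set.mem_ofPred_eq, not_or, not_and, not_le, not_exists] at hω
  constructor
  · have hdev := hω.1 hn0
    rw [← hprob] at hdev
    have hsq : √(L / (2 * n h ω)) ≤ ε / (D * √(ν.reach h.1)) := by
      refine Real.sqrt_le_iff.2 ⟨by positivity, ?_⟩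
      rw [div_pow, mul_pow, Real.sq_sqrt hr0, div_le_div_iff₀ (by positivity) (by positivity)]
      have e : ν.reach h.1 * (D ^ 2 / (2 * ε ^ 2)) * L * (2 * ε ^ 2) =
          L * (D ^ 2 * ν.reach h.1) := by
        field_simp
      have := mul_le_mul_of_nonneg_right hsize (show 0 ≤ 2 * ε ^ 2 by positivity)
      linarith
    have hs1 : √(ν.reach h.1) ≤ 1 := Real.sqrt_le_one.2 hr1
    calc ν.reach h.1 * |ν.prob h.1 a.1 - ρ.prob h.1 a.1|
        ≤ ν.reach h.1 * (ε / (D * √(ν.reach h.1))) :=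
          mul_le_mul_of_nonneg_left (hdev.le.trans hsq) hr0
      _ = √(ν.reach h.1) * (ε / D) := by
          have hs : 0 < √(ν.reach h.1) := Real.sqrt_pos.2 hr
          nth_rewrite 1 [← Real.mul_self_sqrt hr0]
          field_simp
      _ ≤ ε / D := mul_le_of_le_one_left (by positivity) hs1
  · intro _ h0
    rw [hprob, Finset.sum_eq_zero, zero_div]
    intro k _
    simp [hω.2 h0 k]

end GameTree

/-! ### Equilibria -/

/-- If a change of nature's strategy moves all values by at most `ε`, it moves the best-response
value and the lower bound of the profile by at most `ε` each. -/
theorem Pseudogame.isNash_of_abs_value_sub_le {P A J : Type*} [Fintype P] (G : Pseudogame P A J)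
    {c : P → ℝ} (hα : ∀ i, ∀ z ∈ G.terminals, c i ≤ G.α i z)
    (hβ : ∀ i, ∀ z ∈ G.terminals, G.β i z ≤ c i + 1) {ν : G.NatureStrategy} {ε : ℝ}
    (hclose : ∀ (u : List A → ℝ) (c : ℝ), (∀ z ∈ G.terminals, c ≤ u z ∧ u z ≤ c + 1) →
      ∀ σ : G.Profile, |GameTree.value ν u σ - GameTree.value G.nature u σ| ≤ ε)
    {ε' : ℝ} {σ : G.Profile} (hσ : (G.withNature ν).IsNash ε' σ) :
    G.IsNash (ε' + 2 * ε) σ := by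
  classical
  intro i
  have hα' : ∀ z ∈ G.terminals, c i ≤ G.α i z ∧ G.α i z ≤ c i + 1 := fun z hz =>
    ⟨hα i z hz, (G.α_le_β i z hz).trans (hβ i z hz)⟩
  have hβ' : ∀ z ∈ G.terminals, c i ≤ G.β i z ∧ G.β i z ≤ c i + 1 := fun z hz =>
    ⟨(hα i z hz).trans (G.α_le_β i z hz), hβ i z hz⟩
  have hbr : G.bestResponse i σ ≤ (G.withNature ν).bestResponse i σ + ε := by
    have : Nonempty (G.Strategy i) := ⟨σ i⟩
    refine ciSup_le fun s => ?_
    have hbdd : BddAbove (Set.range fun s : G.Strategy i =>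
        GameTree.value ν (G.β i) (Function.update σ i s)) :=
      ⟨c i + 1, by rintro _ ⟨s, rfl⟩; exact (GameTree.value_mem_Icc ν _ hβ').2⟩
    have h1 : GameTree.value ν (G.β i) (Function.update σ i s) ≤
        (G.withNature ν).bestResponse i σ := by
      unfold Pseudogame.bestResponse
      exact le_ciSup hbdd s
    have h2 := (abs_le.1 (hclose (G.β i) (c i) hβ' (Function.update σ i s))).1
    linarith
  have hval := (abs_le.1 (hclose (G.α i) (c i) hα' σ)).2
  have hi : (G.withNature ν).bestResponse i σ - GameTree.value ν (G.α i) σ ≤ ε' := hσ i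
  linarith

/-! ### The sampling bound -/

theorem mainTheorem8 {P A J : Type*} [Fintype P] (G : Pseudogame P A J)
    -- bounded payoffs: those of each player lie in an interval of unit length
    (c : P → ℝ)
    (hα : ∀ i, ∀ z ∈ G.terminals, c i ≤ G.α i z)
    (hβ : ∀ i, ∀ z ∈ G.terminals, G.β i z ≤ c i + 1)
    (ε δ : ℝ) (hε : 0 < ε) (hδ : 0 < δ)
    -- independent samples `X h 0, X h 1, …` of nature's distribution at each nature node `h`
    {Ω : Type*} [MeasurableSpace Ω] (μ : Measure Ω) [IsProbabilityMeasure μ]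
    (X : ∀ h : G.NatureNode, ℕ → Ω → G.Action h)
    (hX : ∀ h k, Measurable (X h k))
    (hlaw : ∀ h k (a : G.Action h), μ.real (X h k ⁻¹' {a}) = G.nature.prob h.1 a.1)
    (hindep : iIndepFun (fun p : G.NatureNode × ℕ => X p.1 p.2) μ)
    -- the sample sizes: constants, or chosen from the samples at the proper ancestors
    (n : G.NatureNode → Ω → ℕ)
    (hn : ∀ h, Measurable[ancestorSamples X h] (n h))
    -- the arbitrary distributions used at unsampled nodes
    (dflt : G.NatureStrategy)
    -- the approximated strategy of nature
    (ν : Ω → G.NatureStrategy)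
    (hν : ∀ ω, ν ω = GameTree.empirical dflt (fun h k => X h k ω) (fun h => n h ω)) :
    1 - 2 * δ * (Fintype.card P : ℝ) ≤ μ.real {ω |
      (∀ h : G.NatureNode, (ν ω).reach h.1 *
          ((GameTree.maxSupport G.nature : ℝ) ^ 2 / (2 * ε ^ 2)) *
            Real.log (2 * (G.H.card : ℝ) / δ) ≤ (n h ω : ℝ)) →
      ∀ (ε' : ℝ) (σ : G.Profile),
        (G.withNature (ν ω)).IsNash ε' σ → G.IsNash (ε' + 2 * ε) σ} := by
  classical
  -- Without players every profile is an equilibrium.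
  rcases isEmpty_or_nonempty P with hP | hP
  · refine le_trans (by simp) (le_of_eq (?_ : (1 : ℝ) = _))
    rw [← probReal_univ (μ := μ)]
    congr 1
    exact (Set.eq_univ_of_forall fun ω _ ε' σ _ i => isEmptyElim i).symm
  have hcard : (1 : ℝ) ≤ Fintype.card P := by exact_mod_cast Fintype.card_pos
  -- For `δ ≥ 1 / 2` the probability bound is nonpositive; below, the logarithm is positive.
  by_cases hδ1 : 1 / 2 ≤ δ
  · refine le_trans ?_ measureReal_nonneg
    nlinarith
  rw [not_le] at hδ1
  have hN : (1 : ℝ) ≤ G.H.card := by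
    exact_mod_cast Finset.card_pos.2 ⟨[], G.root_mem⟩
  set L := Real.log (2 * (G.H.card : ℝ) / δ) with hLdef
  have hL : 0 < L := Real.log_pos ((one_lt_div hδ).2 (by linarith))
  have hexp : 2 * Real.exp (-L) = δ / G.H.card := by
    rw [Real.exp_neg, Real.exp_log (by positivity)]
    field_simp
  have := Fintype.ofFinite (Σ h : G.NatureNode, G.Action h)
  -- There are at most `N` events of probability at most `δ / N` each; the remaining argument is
  -- deterministic, so the event need not be treated separately for each player and bound.
  set bad : Set Ω := ⋃ p : Σ h : G.NatureNode, G.Action h,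
    GameTree.BadEvent G.nature X n L p.1 p.2 with hbad
  have hμbad : μ.real bad ≤ δ := by
    calc μ.real bad ≤ ∑ p : Σ h : G.NatureNode, G.Action h,
          μ.real (GameTree.BadEvent G.nature X n L p.1 p.2) := measureReal_iUnion_fintype_le _
      _ ≤ ∑ _p : Σ h : G.NatureNode, G.Action h, δ / G.H.card :=
          Finset.sum_le_sum fun p _ => hexp ▸
            GameTree.measureReal_badEvent_le hX hlaw hindep hn hL.le p.1 p.2
      _ = Fintype.card (Σ h : G.NatureNode, G.Action h) * (δ / G.H.card) := by simp
      _ ≤ G.H.card * (δ / G.H.card) := by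
          have := GameTree.card_natureActions_le (T := G.toGameTree)
          gcongr
      _ = δ := by field_simp
  have hsub : badᶜ ⊆ {ω |
      (∀ h : G.NatureNode, (ν ω).reach h.1 *
          ((GameTree.maxSupport G.nature : ℝ) ^ 2 / (2 * ε ^ 2)) * L ≤ (n h ω : ℝ)) →
      ∀ (ε' : ℝ) (σ : G.Profile),
        (G.withNature (ν ω)).IsNash ε' σ → G.IsNash (ε' + 2 * ε) σ} := by
    intro ω hω hsize ε' σ hσ
    have hω' : ∀ (h : G.NatureNode) (a : G.Action h),
        ω ∉ GameTree.BadEvent G.nature X n L h a := fun h a hb =>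
      hω (Set.mem_iUnion.2 ⟨⟨h, a⟩, hb⟩)
    have hD : (1 : ℝ) ≤ GameTree.maxSupport G.nature := GameTree.one_le_maxSupport G.nature σ
    have key := fun (h : G.NatureNode) (a : G.Action h) =>
      GameTree.reach_mul_abs_empirical_sub_le (ρ := G.nature) hL hε (by linarith) (hν ω) h
        (hsize h) a (hω' h a)
    refine G.isNash_of_abs_value_sub_le hα hβ (fun u c hu σ => ?_) hσ
    refine (GameTree.abs_value_sub_value_le σ (η := ε / GameTree.maxSupport G.nature)
      (by positivity) hu (fun h hh a ha => (key ⟨h, hh⟩ ⟨a, ha⟩).1)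
      fun h hh hr a ha => (key ⟨h, hh⟩ ⟨a, ha⟩).2 hr).trans ?_
    calc ε / GameTree.maxSupport G.nature * ((GameTree.maxSupport G.nature : ℝ) - 1)
        ≤ ε / GameTree.maxSupport G.nature * GameTree.maxSupport G.nature := by gcongr; linarith
      _ = ε := by field_simp
  calc 1 - 2 * δ * (Fintype.card P : ℝ) ≤ 1 - μ.real bad := by nlinarith
    _ ≤ μ.real badᶜ := by
      have := measureReal_union_le (μ := μ) bad badᶜ
      rw [Set.union_compl_self, probReal_univ] at this
      linarith
    _ ≤ _ := measureReal_mono hsub
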